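/- A forcing notion $\mathbb P$ is a partially ordered set (or, more generally, a preordered set) in the universe $V$; stronger conditions are smaller, and $\Gamma_{\mathbb P}$ denotes the canonical name of the generic filter. For a cardinal $\theta$, $H(\theta)$ is the collection of sets whose transitive closure has size less than $\theta$. For a countable $M\prec H(\theta)$ with $\mathbb P\in M$, a condition $q$ is $(M,\mathbb P)$-generic if $q\Vdash \Gamma_{\mathbb P}\cap D\cap M\neq\emptyset$ for every dense $D\subseteq\mathbb P$ with $D\in M$. $\mathbb P$ has property $(\dagger)$ if for all sufficiently large regular $\theta$ the following holds: for every countable elementary submodel $M\prec H(\theta)$ with $\mathbb P\in M$, every $p\in\mathbb P\cap M$, and all functions $\varphi_i:\mathbb P\cap M\to\mathbb P\cap M$ $(i\in\omega)$ with $\varphi_i(r)\le r$ for all $r\in\mathbb P\cap M$ and $i\in\omega$, there is an $(M,\mathbb P)$-generic condition $q\le p$ such that $$q\Vdash\ \text{“}\Gamma_{\mathbb P}\cap\{\varphi_i(r): r\in\mathbb P\cap M\}\text{ is infinite for all } i\in\omega\text{”}.$$ A real $g\in\omega^\omega$ of a generic extension is eventually different if for every $y\in\omega^\omega\cap V$ the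 set $\{n\in\omega: y(n)=g(n)\}$ is finite. **Proposition.** If a forcing notion $\mathbb P$ satisfies $(\dagger)$, then every condition of $\mathbb P$ forces that there is no eventually different real in $V^{\mathbb P}$. Consequently, none of the following satisfies $(\dagger)$: 1. random forcing: the Borel subsets of $[0,1]$ of positive Lebesgue measure, identified modulo null sets and ordered by inclusion modulo null sets; 2. Hechler forcing: the pairs $(n,f)\in\omega\times\omega^\omega$, ordered by $(m,g)\le(n,f)$ iff $n\le m$, $g\restriction n=f\restriction n$ and $f(k)\le g(k)$ for all $k$; 3. Laver forcing: the trees $T\subseteq\omega^{<\omega}$ (closed under initial segments) having a stem $s\in T$, comparable with every node of $T$, such that each node of $T$ extending $s$ has infinitely many immediate successors in $T$, ordered by inclusion. -/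

import Mathlib

universe u v

noncomputable section

namespace DaggerForcing

/-! ### The language of set theory, `H(θ)`, countable elementary submodels -/

/-- The only non-logical symbol of the language of set theory: a binary relation. -/
inductive SetRel : ℕ → Type
  | mem : SetRel 2

/-- The first-order language of set theory. -/
def setLanguage : FirstOrder.Language := ⟨fun _ => Empty, SetRel⟩

/-- `H(θ)`: the sets whose transitive closure has size less than `θ`, inside the universe
`V = ZFSet.{u}`. -/
def H (θ : Cardinal.{u}) : Set ZFSet.{u} :=
  {x | ∃ t : ZFSet.{u}, t.IsTransitive ∧ x ⊆ t ∧ t.card < θ}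

/-- `H(θ)` as a structure for the language of set theory, with the true membership relation. -/
instance structureH (θ : Cardinal.{u}) : setLanguage.Structure (H θ) where
  funMap := fun f => f.elim
  RelMap := fun r => match r with
    | SetRel.mem => fun x => (x 0 : ZFSet.{u}) ∈ (x 1 : ZFSet.{u})

/-- The set `(ℙ, ≤_ℙ)` of the universe `ZFSet.{u}` that an embedding `e` of the elements of `P`
into the universe gives rise to: the pair of `{e p : p ∈ P}` and `{(e p, e q) : p ≤ q}`. -/
def posetSet {P : Type v} [Preorder P] [Small.{u} P] (e : P ↪ ZFSet.{u}) : ZFSet.{u} :=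
  ZFSet.pair (ZFSet.range e)
    (ZFSet.range fun x : {x : P × P // x.1 ≤ x.2} => ZFSet.pair (e x.1.1) (e x.1.2))

/-! ### Forced statements

A statement about the generic extension is represented by the set of conditions forcing it:
for `φ : Stmt P`, `φ p` reads `p ⊩ φ`. The clauses are the usual ones of the (strong, that is
semantical) forcing relation. -/

abbrev Stmt (P : Type v) := P → Prop

section Stmt

variable {P : Type v} [Preorder P]

/-- Negation: `p ⊩ ¬φ` iff no `q ≤ p` forces `φ`. -/
def fnot (φ : Stmt P) : Stmt P := fun p => ∀ q ≤ p, ¬ φ q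

/-- Conjunction. -/
def fand (φ ψ : Stmt P) : Stmt P := fun p => φ p ∧ ψ p

/-- Implication: `p ⊩ φ → ψ` iff every `q ≤ p` forcing `φ` forces `ψ`. -/
def fimp (φ ψ : Stmt P) : Stmt P := fun p => ∀ q ≤ p, φ q → ψ q

/-- Universal quantification. With `ι` the type of names this is the quantifier over the generic
extension; with `ι` a type of ground model objects it is the quantifier over that ground model
set. -/
def fall {ι : Type*} (φ : ι → Stmt P) : Stmt P := fun p => ∀ i, φ i p

/-- Existential quantification: densely many conditions below `p` force some instance. -/
def fex {ι : Type*} (φ : ι → Stmt P) : Stmt P := fun p => ∀ q ≤ p, ∃ r ≤ q, ∃ i, φ i r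

/-- "The set `{i ∈ ι : φ i}` is finite", for a ground model set `ι`. Finite subsets of ground
model sets belong to the ground model, so this says that some finite `F ⊆ ι` contains it. -/
def finitelyMany {ι : Type*} (φ : ι → Stmt P) : Stmt P :=
  fex fun F : Finset ι => fall fun i : {i : ι // i ∉ F} => fnot (φ i)

/-- "The set `{i ∈ ι : φ i}` is infinite", for a ground model set `ι`. -/
def infinitelyMany {ι : Type*} (φ : ι → Stmt P) : Stmt P := fnot (finitelyMany φ)

/-- "`a ∈ Γ`", where `Γ` is the canonical name of the generic filter: the conditions below `a`
are dense below `p`. -/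
def inGeneric (a : P) : Stmt P := fun p => ∀ q ≤ p, ∃ r ≤ q, r ≤ a

end Stmt

/-! ### Property (†) -/

/-- Density of a set of conditions. -/
def IsDense {P : Type v} [Preorder P] (D : Set P) : Prop := ∀ p, ∃ d ∈ D, d ≤ p

section Dagger

variable {P : Type v} [Preorder P] [Small.{u} P]

/-- `q` is `(M, ℙ)`-generic: it forces the generic filter to meet `D ∩ M` for every dense
`D ⊆ ℙ` with `D ∈ M`. Here `e p` is the set of the universe that represents the condition `p`. -/
def IsGenericCondition (e : P ↪ ZFSet.{u}) (M : Set ZFSet.{u}) (q : P) : Prop :=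
  ∀ D : Set P, IsDense D → ZFSet.range (fun d : D => e d) ∈ M →
    fex (fun d : {d : P // d ∈ D ∧ e d ∈ M} => inGeneric d.1) q

/-- Property (†) of the forcing notion `P`, whose elements are identified with sets through `e`:
for all sufficiently large regular `θ`, every countable elementary submodel `M` of `H(θ)`
containing the poset, every `p ∈ ℙ ∩ M` and all regressive `φ i : ℙ ∩ M → ℙ ∩ M`, there is an
`(M, ℙ)`-generic `q ≤ p` forcing `Γ ∩ {φ i r : r ∈ ℙ ∩ M}` to be infinite for all `i`. -/
def Dagger (e : P ↪ ZFSet.{u}) : Prop :=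
  ∃ θ₀ : Cardinal.{u}, ∀ θ : Cardinal.{u}, θ₀ ≤ θ → θ.IsRegular →
    ∀ N : setLanguage.ElementarySubstructure (H θ),
      ∀ M : Set ZFSet.{u}, M = Subtype.val '' (N : Set (H θ)) →
      M.Countable → posetSet e ∈ M →
      ∀ p : P, e p ∈ M →
      ∀ φ : ℕ → {r : P // e r ∈ M} → {r : P // e r ∈ M}, (∀ i r, φ i r ≤ r) →
        ∃ q ≤ p, IsGenericCondition e M q ∧
          fall (fun i : ℕ =>
            infinitelyMany fun a : Set.range (φ i) => inGeneric (a.1.1 : P)) q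

end Dagger

/-! ### Names, and reals of the generic extension -/

/-- `P`-names: a name is a (small) family of pairs (name, condition). -/
inductive PName (P : Type v) : Type (max v (u + 1))
  | mk (ι : Type u) (name : ι → PName P) (cond : ι → P) : PName P

namespace PName

variable {P : Type v} [Preorder P]

/-- `p ⊩ σ = τ`: every element of `σ` is forced to be in `τ` by the conditions that put it into
`σ`, and conversely. -/
def eq : PName.{u, v} P → PName.{u, v} P → Stmt P
  | mk _ x c, mk _ y d => fun p =>
    (∀ i, ∀ q ≤ p, q ≤ c i → ∀ r ≤ q, ∃ s ≤ r, ∃ j, s ≤ d j ∧ eq (x i) (y j) s) ∧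
    (∀ j, ∀ q ≤ p, q ≤ d j → ∀ r ≤ q, ∃ s ≤ r, ∃ i, s ≤ c i ∧ eq (x i) (y j) s)

/-- `p ⊩ σ ∈ τ`: densely many `r` below `p` satisfy, for some `(π, s) ∈ τ`, both `r ≤ s` and
`r ⊩ σ = π`. -/
def mem (σ : PName.{u, v} P) : PName.{u, v} P → Stmt P
  | mk _ y d => fun p => ∀ q ≤ p, ∃ r ≤ q, ∃ j, r ≤ d j ∧ eq σ (y j) r

variable [Small.{u} P]

/-- The canonical name of a pre-set: `x̌ = {(y̌, p) : y ∈ x, p ∈ ℙ}`. -/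
def checkPSet : PSet.{u} → PName.{u, v} P
  | ⟨α, A⟩ => mk (α × Shrink.{u} P) (fun i => checkPSet (A i.1)) (fun i => (equivShrink P).symm i.2)

/-- The canonical name `x̌` of a ground model set `x`. -/
def check (x : ZFSet.{u}) : PName.{u, v} P := checkPSet x.out

end PName

/-- The von Neumann natural number `n`. -/
def natSet (n : ℕ) : ZFSet.{u} := ZFSet.mk (PSet.ofNat n)

section Reals

variable {P : Type v} [Preorder P] [Small.{u} P]

/-- "`(n, m) ∈ τ`"; for a name `τ` of a function this says "`τ(n) = m`". -/
def hasValue (τ : PName.{u, v} P) (n m : ℕ) : Stmt P :=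
  PName.mem (PName.check (ZFSet.pair (natSet n) (natSet m))) τ

/-- "`τ` is a real, that is, `τ : ω → ω`": `τ` is a subset of `ω × ω`, total and single-valued. -/
def isReal (τ : PName.{u, v} P) : Stmt P :=
  fand
    (fall fun z : PName.{u, v} P => fimp (PName.mem z τ)
      (PName.mem z (PName.check (ZFSet.prod ZFSet.omega ZFSet.omega))))
    (fand
      (fall fun n : ℕ => fex fun m : ℕ => hasValue τ n m)
      (fall fun n : ℕ => fall fun m : ℕ => fall fun m' : ℕ =>
        fimp (fand (hasValue τ n m) (hasValue τ n m'))
          (PName.eq (PName.check (natSet m)) (PName.check (natSet m')))))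

/-- "`τ` is eventually different": for every ground model `y : ω → ω` the set
`{n : y(n) = τ(n)}` is finite. -/
def isEventuallyDifferent (τ : PName.{u, v} P) : Stmt P :=
  fall fun y : ℕ → ℕ => finitelyMany fun n : ℕ => hasValue τ n (y n)

variable (P) in
/-- Every condition forces that there is no eventually different real. -/
def NoEventuallyDifferentReals : Prop :=
  ∀ p : P, fnot (fex fun τ : PName.{u, v} P => fand (isReal τ) (isEventuallyDifferent τ)) p

end Reals

/-! ### Random, Hechler and Laver forcing -/

/-- Borel subsets of `[0,1]` of positive Lebesgue measure. -/
def PositiveBorel : Type :=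
  {A : Set ℝ // A ⊆ Set.Icc 0 1 ∧ MeasurableSet A ∧ MeasureTheory.volume A ≠ 0}

/-- Inclusion modulo null sets. -/
instance : Preorder PositiveBorel where
  le A B := MeasureTheory.volume (A.1 \ B.1) = 0
  le_refl A := by simp
  le_trans A B C hAB hBC := by
    refine MeasureTheory.measure_mono_null (t := (A.1 \ B.1) ∪ (B.1 \ C.1)) ?_ ?_
    · intro x hx
      by_cases h : x ∈ B.1
      · exact Or.inr ⟨h, hx.2⟩
      · exact Or.inl ⟨hx.1, h⟩
    · exact MeasureTheory.measure_union_null hAB hBC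

/-- Random forcing: the Borel sets of positive measure, ordered by inclusion modulo null sets and
identified modulo null sets, i.e. the nonzero elements of the measure algebra. -/
abbrev RandomForcing : Type := Antisymmetrization PositiveBorel (· ≤ ·)

/-- Conditions `(n, f)` of Hechler forcing: `f : ω → ω`, and `f ↾ n` is the part decided. -/
structure HechlerForcing : Type where
  len : ℕ
  fn : ℕ → ℕ

/-- `(m, g) ≤ (n, f)` iff `n ≤ m`, `g ↾ n = f ↾ n` and `f ≤ g` everywhere. -/
instance : PartialOrder HechlerForcing where
  le a b := b.len ≤ a.len ∧ (∀ k < b.len, a.fn k = b.fn k) ∧ ∀ k, b.fn k ≤ a.fn k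
  le_refl a := ⟨le_rfl, fun _ _ => rfl, fun _ => le_rfl⟩
  le_trans a b c hab hbc := ⟨hbc.1.trans hab.1,
    fun k hk => (hab.2.1 k (hk.trans_le hbc.1)).trans (hbc.2.1 k hk),
    fun k => (hbc.2.2 k).trans (hab.2.2 k)⟩
  le_antisymm a b hab hba := by
    cases a; cases b
    simp only [HechlerForcing.mk.injEq]
    exact ⟨le_antisymm hba.1 hab.1, funext fun k => le_antisymm (hba.2.2 k) (hab.2.2 k)⟩

/-- `T ⊆ ω^{<ω}` is a Laver tree: closed under initial segments, with a stem `s ∈ T` comparable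
with all nodes, such that every node extending `s` has infinitely many immediate successors. -/
def IsLaverTree (T : Set (List ℕ)) : Prop :=
  (∀ t ∈ T, ∀ s, s <+: t → s ∈ T) ∧
  ∃ s ∈ T, (∀ t ∈ T, t <+: s ∨ s <+: t) ∧
    ∀ t ∈ T, s <+: t → {n : ℕ | t ++ [n] ∈ T}.Infinite

/-- Laver forcing: the Laver trees, ordered by inclusion. -/
abbrev LaverForcing : Type := {T : Set (List ℕ) // IsLaverTree T}

end DaggerForcing

end

/-!
Suppose that `p₀` forces `τ` to be an eventually different real. Take a countable elementary
submodel `M` of `H(θ)` whose set `S` of conditions is closed under a function choosing, for `r`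
compatible with `p₀` and `n ∈ ω`, an extension of `r` that decides `τ(n)`. Enumerate `S` as
`r₀, r₁, …`, let `ψ(rₙ) ≤ rₙ` decide `τ(n)` whenever `rₙ` is compatible with `p₀`, and let `y(n)`
be the decided value. Property (†) gives `q ≤ p₀` forcing infinitely many `ψ(rₙ)` into the generic
filter; the corresponding `rₙ` are compatible with `p₀`, so `τ(n) = y(n)` for infinitely many
`n`, a contradiction (`Dagger.noEventuallyDifferentReals`). One function `ψ` suffices, and the
`(M, ℙ)`-genericity of `q` plays no role. Instead of putting `τ` into `M`, the closure of `M` is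
obtained by adding the choice functions to the Skolem functions of `H(θ)`
(`exists_countable_elementarySubstructure_closed`).

For the three examples it remains to exhibit an eventually different real. Equality of canonical
names is absolute (`eq_checkPSet_iff`), so a relation `A n m p`, "`p` decides the `n`-th value to be
`m`", can be turned into a name, and `not_noEventuallyDifferentReals` reduces the task to density
arguments on `A`. The Hechler real dominates the ground model reals; a Laver tree stays a Laver tree
after removing the nodes that agree with `y` beyond the stem; and for a random real `x` the function
`n ↦ ⌊2ⁿ x⌋` is eventually different by the Borel–Cantelli lemma.
-/

open FirstOrder Cardinal

namespace DaggerForcing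

/-! ### Countable elementary substructures closed under given functions -/

/-- The language with unary function symbols indexed by `ℕ` and no other symbols. -/
def unaryLanguage : FirstOrder.Language := ⟨fun n => {_i : ℕ // n = 1}, fun _ => Empty⟩

/-- The structure interpreting the `i`-th function symbol of `unaryLanguage` by `F i`. -/
@[reducible] def unaryStructure {A : Type*} (F : ℕ → A → A) : unaryLanguage.Structure A where
  funMap := fun f x => F f.1 (x ⟨0, by have := f.2; omega⟩)
  RelMap := fun r => r.elim

theorem exists_countable_elementarySubstructure_closed {L : FirstOrder.Language.{0, 0}}
    (hL : L.card ≤ ℵ₀) {A : Type v} [L.Structure A] (s : Set A) (hs : s.Countable)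
    (F : ℕ → A → A) :
    ∃ N : L.ElementarySubstructure A, s ⊆ N ∧ (N : Set A).Countable ∧
      ∀ i, ∀ a ∈ N, F i a ∈ N := by
  rcases isEmpty_or_nonempty A with hA | hA
  · exact ⟨⊤, fun a => isEmptyElim a, Set.to_countable _, fun i a => isEmptyElim a⟩
  let := unaryStructure F
  let L₁ := L.sum L.skolem₁
  let L₂ := L₁.sum unaryLanguage
  have h₁ : Countable (Σ n, L₁.Functions n) := by
    rw [← Cardinal.mk_le_aleph0_iff]
    exact Language.card_functions_sum_skolem₁_le.trans (max_le le_rfl hL)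
  have h₂ : Countable (Σ n, L₂.Functions n) := by
    have h₀ (n : ℕ) : Countable (L₁.Functions n) :=
      Function.Injective.countable (f := Sigma.mk n) sigma_mk_injective
    have h₃ (n : ℕ) : Countable (unaryLanguage.Functions n) :=
      inferInstanceAs (Countable {_i : ℕ // n = 1})
    have (n : ℕ) : Countable (L₂.Functions n) :=
      inferInstanceAs (Countable (L₁.Functions n ⊕ unaryLanguage.Functions n))
    infer_instance
  let S : L₂.Substructure A := Language.Substructure.closure L₂ s
  let S₁ : L₁.Substructure A := Language.LHom.sumInl.substructureReduct S
  have hmem (a : A) : a ∈ S₁.elementarySkolem₁Reduct ↔ a ∈ S := Iff.rfl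
  refine ⟨S₁.elementarySkolem₁Reduct, ?_, ?_, fun i a ha => ?_⟩
  · exact Language.Substructure.subset_closure
  · exact hs.substructure_closure L₂
  · rw [hmem] at ha ⊢
    let f : unaryLanguage.Functions 1 := ⟨i, rfl⟩
    exact S.fun_mem (Sum.inr f) ![a] (by intro j; simpa using ha)

theorem card_setLanguage_le : setLanguage.card ≤ ℵ₀ := by
  have h (n : ℕ) : Countable (setLanguage.Functions n) := inferInstanceAs (Countable Empty)
  have h' (n : ℕ) : Countable (setLanguage.Relations n) := by
    refine Function.Injective.countable (f := fun _ => 0) (β := ℕ) ?_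
    rintro ⟨⟩ ⟨⟩ -
    rfl
  exact Cardinal.mk_le_aleph0_iff.2
    (inferInstanceAs (Countable ((Σ n, setLanguage.Functions n) ⊕ Σ n, setLanguage.Relations n)))

section Dagger

variable {P : Type v} [Preorder P] [Small.{u} P]

/-- For all sufficiently large regular `θ`, the poset and all its conditions are in `H(θ)`. -/
theorem exists_isRegular_mem_H (e : P ↪ ZFSet.{u}) (θ₀ : Cardinal.{u}) :
    ∃ θ, θ₀ ≤ θ ∧ θ.IsRegular ∧ posetSet e ∈ H θ ∧ ∀ p, e p ∈ H θ := by
  obtain ⟨o, ho⟩ := ZFSet.exists_mem_vonNeumann (posetSet e)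
  have htr := ZFSet.isTransitive_vonNeumann o
  have hlt : (ZFSet.vonNeumann o).card <
      Order.succ (max (max ℵ₀ θ₀) (ZFSet.vonNeumann o).card) :=
    Order.lt_succ_of_le (le_max_right _ _)
  refine ⟨_, ((le_max_right _ _).trans (le_max_left _ _)).trans (Order.le_succ _),
    Cardinal.isRegular_succ ((le_max_left _ _).trans (le_max_left _ _)),
    ⟨_, htr, htr _ ho, hlt⟩, fun p => ⟨_, htr, ?_, hlt⟩⟩
  have h₁ : {ZFSet.range e} ∈ posetSet e := by
    simp [posetSet, ZFSet.pair]
  have h₂ := htr _ (htr _ ho h₁) (ZFSet.mem_singleton.2 rfl)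
  exact htr _ (htr _ h₂ (ZFSet.mem_range_self p))

/-- The form of (†) that is used: the conditions in `M` are a countable set closed under the given
functions, and genericity is dropped. -/
theorem Dagger.exists_countable_closed {e : P ↪ ZFSet.{u}} (he : Dagger e) (p : P)
    (G : ℕ → P → P) :
    ∃ S : Set P, S.Countable ∧ p ∈ S ∧ (∀ n, ∀ r ∈ S, G n r ∈ S) ∧
      ∀ ψ : S → S, (∀ r, ψ r ≤ r) →
        ∃ q ≤ p, infinitelyMany (fun a : Set.range ψ => inGeneric (a.1.1 : P)) q := by
  classical
  obtain ⟨θ₀, hθ₀⟩ := he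
  obtain ⟨θ, hle, hreg, hP, hmem⟩ := exists_isRegular_mem_H e θ₀
  let E : P → H θ := fun r => ⟨e r, hmem r⟩
  have hE : Function.Injective E := fun a b h => e.injective (congrArg Subtype.val h)
  -- transport `G` along `E` to functions on `H(θ)`, the identity off the conditions
  let F : ℕ → H θ → H θ := fun n => Function.extend E (fun r => E (G n r)) id
  obtain ⟨N, hsN, hN, hF⟩ := exists_countable_elementarySubstructure_closed card_setLanguage_le
    {⟨posetSet e, hP⟩, E p} ((Set.countable_singleton _).insert _) F
  let M : Set ZFSet.{u} := Subtype.val '' (N : Set (H θ))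
  have hM (r : P) : e r ∈ M ↔ E r ∈ N := by
    constructor
    · rintro ⟨x, hx, hxr⟩
      have : x = E r := Subtype.ext hxr
      exact this ▸ hx
    · exact fun h => ⟨E r, h, rfl⟩
  have hpM : e p ∈ M := (hM p).2 (hsN (by simp))
  refine ⟨{r | e r ∈ M}, (hN.image _).preimage e.injective, hpM, fun n r hr => ?_,
    fun ψ hψ => ?_⟩
  · have := hF n _ ((hM r).1 hr)
    rw [show F n (E r) = E (G n r) from hE.extend_apply _ _ _] at this
    exact (hM _).2 this
  · obtain ⟨q, hq, -, h⟩ := hθ₀ θ hle hreg N M rfl (hN.image _)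
      ⟨_, hsN (Set.mem_insert _ _), rfl⟩ p hpM
      (fun _ => ψ) (fun _ => hψ)
    exact ⟨q, hq, h 0⟩

/-! ### Property (†) adds no eventually different real -/

theorem hasValue_mono {τ : PName.{u, v} P} {n m : ℕ} {p q : P} (h : hasValue τ n m p)
    (hq : q ≤ p) : hasValue τ n m q := by
  cases τ
  exact fun r hr => h r (hr.trans hq)

/-- A countable family `S` of conditions, closed under deciding values of `τ` below `p₀`, is
enumerated in type `ω`, and the `n`-th condition is extended to one deciding `τ n`. The decided
values form a ground model real which `τ` meets whenever one of the extensions is generic. -/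
theorem Dagger.noEventuallyDifferentReals {e : P ↪ ZFSet.{u}} (he : Dagger e) :
    NoEventuallyDifferentReals.{u, v} P := by
  classical
  intro p₁ p₂ _ hp₂
  obtain ⟨p₀, -, τ, ⟨-, htot, -⟩, hed⟩ := hp₂ p₂ le_rfl
  have hdec (n : ℕ) (r : P) : ∃ s ≤ r, (∃ t ≤ r, t ≤ p₀) → ∃ m, hasValue τ n m s := by
    by_cases h : ∃ t ≤ r, t ≤ p₀
    · obtain ⟨t, htr, htp⟩ := h
      obtain ⟨s, hs, m, hm⟩ := htot n t htp
      exact ⟨s, hs.trans htr, fun _ => ⟨m, hm⟩⟩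
    · exact ⟨r, le_rfl, fun h' => absurd h' h⟩
  choose G hG hGval using hdec
  obtain ⟨S, hSc, -, hSG, hS⟩ := he.exists_countable_closed p₀ G
  have := hSc.to_subtype
  obtain ⟨idx, hidx⟩ := exists_injective_nat S
  let ψ : S → S := fun r => ⟨G (idx r) r, hSG _ _ r.2⟩
  have hy (n : ℕ) : ∃ m, ∀ r : S, idx r = n → (∃ t ≤ r.1, t ≤ p₀) →
      hasValue τ n m (ψ r : P) := by
    by_cases h : ∃ r : S, idx r = n ∧ ∃ t ≤ r.1, t ≤ p₀
    · obtain ⟨r, rfl, hr⟩ := h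
      obtain ⟨m, hm⟩ := hGval (idx r) r hr
      refine ⟨m, fun r' hr' _ => ?_⟩
      rw [hidx hr']
      exact hm
    · exact ⟨0, fun r hr ht => absurd ⟨r, hr, ht⟩ h⟩
  choose y hy using hy
  obtain ⟨q, hq, hinf⟩ := hS ψ (fun r => hG _ _)
  refine hinf q le_rfl fun r hr => ?_
  obtain ⟨r', hr', F, hF⟩ := hed y r (hr.trans hq)
  refine ⟨r', hr', (F.preimage idx hidx.injOn).image fun a => ⟨ψ a, a, rfl⟩, ?_⟩
  rintro ⟨⟨_, a, rfl⟩, ha⟩ s hs hgen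
  have haF : idx a ∉ F := fun h =>
    ha (Finset.mem_image.2 ⟨a, Finset.mem_preimage.2 h, rfl⟩)
  obtain ⟨t, hts, hta⟩ := hgen s le_rfl
  have htp : t ≤ p₀ := hts.trans (hs.trans (hr'.trans (hr.trans hq)))
  have hval := hy (idx a) a rfl ⟨t, hta.trans (hG _ _), htp⟩
  exact hF ⟨idx a, haF⟩ t (hts.trans hs) (hasValue_mono hval hta)

end Dagger

/-! ### Canonical names -/

theorem natSet_injective : Function.Injective natSet.{u} := by
  have h (n : ℕ) : (natSet.{u} n).rank = n := by
    induction n with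
    | zero => exact ZFSet.rank_empty
    | succ n ih =>
      change (insert (natSet.{u} n) (natSet.{u} n)).rank = _
      rw [ZFSet.rank_insert, ih, Nat.cast_succ, Order.succ_eq_add_one]
      exact max_eq_left le_self_add
  intro m n hmn
  have := h m
  rw [hmn, h n] at this
  exact_mod_cast this.symm

theorem natSet_mem_omega (n : ℕ) : natSet.{u} n ∈ ZFSet.omega.{u} :=
  ⟨⟨n⟩, PSet.Equiv.refl _⟩

theorem checkPSet_eq_mk {P : Type v} [Small.{u} P] (x : PSet.{u}) :
    PName.checkPSet (P := P) x = .mk (x.Type × Shrink.{u} P)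
      (fun i => PName.checkPSet (x.Func i.1)) (fun i => (equivShrink P).symm i.2) := by
  cases x
  rfl

section Names

variable {P : Type v} [Preorder P] [Small.{u} P]

/-- Equality of canonical names is absolute. -/
theorem eq_checkPSet_iff (x y : PSet.{u}) (p : P) :
    PName.eq (PName.checkPSet x) (PName.checkPSet (P := P) y) p ↔ PSet.Equiv x y := by
  induction x generalizing y p with
  | mk α A ih =>
    obtain ⟨β, B⟩ := y
    simp only [PName.checkPSet, PName.eq, PSet.Equiv]
    constructor
    · rintro ⟨h₁, h₂⟩
      refine ⟨fun a => ?_, fun b => ?_⟩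
      · obtain ⟨s, -, j, -, h⟩ := h₁ (a, equivShrink P p) p le_rfl (by simp) p le_rfl
        exact ⟨j.1, (ih a _ _).1 h⟩
      · obtain ⟨s, -, i, -, h⟩ := h₂ (b, equivShrink P p) p le_rfl (by simp) p le_rfl
        exact ⟨i.1, (ih i.1 _ _).1 h⟩
    · rintro ⟨h₁, h₂⟩
      refine ⟨fun i q _ _ r _ => ?_, fun j q _ _ r _ => ?_⟩
      · obtain ⟨b, hb⟩ := h₁ i.1
        exact ⟨r, le_rfl, (b, equivShrink P r), by simp, (ih _ _ _).2 hb⟩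
      · obtain ⟨a, ha⟩ := h₂ j.1
        exact ⟨r, le_rfl, (a, equivShrink P r), by simp, (ih _ _ _).2 ha⟩

/-- The set `ω × ω` of the universe, represented by a pre-set. -/
noncomputable def omegaProd : PSet.{u} := (ZFSet.prod ZFSet.omega ZFSet.omega).out

theorem exists_mk_omegaProd_eq (n m : ℕ) :
    ∃ i, ZFSet.mk (omegaProd.{u}.Func i) = ZFSet.pair (natSet n) (natSet m) := by
  have h : ZFSet.pair (natSet.{u} n) (natSet m) ∈ ZFSet.prod ZFSet.omega ZFSet.omega :=
    ZFSet.pair_mem_prod.2 ⟨natSet_mem_omega n, natSet_mem_omega m⟩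
  rw [← Quotient.out_eq (ZFSet.prod ZFSet.omega ZFSet.omega),
    ← Quotient.out_eq (ZFSet.pair (natSet.{u} n) (natSet m))] at h
  obtain ⟨i, hi⟩ := h
  refine ⟨i, ?_⟩
  rw [← Quotient.out_eq (ZFSet.pair (natSet.{u} n) (natSet m))]
  exact (Quotient.sound hi).symm

/-- The name of the set of pairs `(n, m)` such that `A n m` holds for some condition in the
generic filter. Its elements are the canonical names occurring in the canonical name of `ω × ω`,
so that it is literally a subname of the latter. -/
noncomputable def relName (A : ℕ → ℕ → P → Prop) : PName.{u, v} P :=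
  .mk {x : omegaProd.{u}.Type × Shrink.{u} P //
      ∃ n m, ZFSet.mk (omegaProd.Func x.1) = ZFSet.pair (natSet n) (natSet m) ∧
        A n m ((equivShrink P).symm x.2)}
    (fun x => PName.checkPSet (omegaProd.Func x.1.1)) (fun x => (equivShrink P).symm x.1.2)

theorem hasValue_relName_iff {A : ℕ → ℕ → P → Prop} (hA : ∀ n m p q, A n m p → q ≤ p → A n m q)
    (n m : ℕ) (p : P) :
    hasValue (relName.{u, v} A) n m p ↔ ∀ q ≤ p, ∃ r ≤ q, A n m r := by
  have key (i : omegaProd.{u}.Type) (r : P) :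
      PName.eq (PName.check (ZFSet.pair (natSet n) (natSet m)))
        (PName.checkPSet (P := P) (omegaProd.{u}.Func i)) r ↔
      ZFSet.mk (omegaProd.Func i) = ZFSet.pair (natSet n) (natSet m) := by
    rw [PName.check, eq_checkPSet_iff, ← ZFSet.eq, eq_comm]
    exact Eq.congr_right (Quotient.out_eq _)
  constructor
  · intro h q hq
    obtain ⟨r, hr, ⟨x, n', m', hx, hA'⟩, hrx, heq⟩ := h q hq
    have := ((key _ _).1 heq).symm.trans hx
    rw [ZFSet.pair_inj, natSet_injective.eq_iff, natSet_injective.eq_iff] at this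
    obtain ⟨rfl, rfl⟩ := this
    exact ⟨r, hr, hA _ _ _ _ hA' hrx⟩
  · intro h q hq
    obtain ⟨r, hr, hAr⟩ := h q hq
    obtain ⟨i, hi⟩ := exists_mk_omegaProd_eq.{u} n m
    exact ⟨r, hr, ⟨(i, equivShrink P r), n, m, hi, by simpa using hAr⟩, by simp, (key _ _).2 hi⟩

/-- A combinatorial criterion for adding an eventually different real, where `A n m p` is to be read
as "`p` decides the `n`-th value of the generic real to be `m`". -/
theorem not_noEventuallyDifferentReals [Nonempty P] (A : ℕ → ℕ → P → Prop)
    (hA : ∀ n m p q, A n m p → q ≤ p → A n m q)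
    (huniq : ∀ n m m' p, A n m p → A n m' p → m = m')
    (htot : ∀ n p, ∃ q ≤ p, ∃ m, A n m q)
    (hdiff : ∀ (y : ℕ → ℕ) (p : P), ∃ q ≤ p, ∃ N, ∀ n, N ≤ n → ∀ r ≤ q, ¬ A n (y n) r) :
    ¬ NoEventuallyDifferentReals.{u, v} P := by
  obtain ⟨p⟩ := ‹Nonempty P›
  intro h
  refine h p p le_rfl fun q _ => ⟨q, le_rfl, relName A, ⟨?_, ?_, ?_⟩, ?_⟩
  · intro z q' _ hz
    change PName.mem z (PName.checkPSet omegaProd) q'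
    rw [checkPSet_eq_mk]
    intro r hr
    obtain ⟨s, hs, x, -, heq⟩ := hz r hr
    exact ⟨s, hs, (x.1.1, equivShrink P s), by simp, heq⟩
  · intro n q' _
    obtain ⟨r, hr, m, hm⟩ := htot n q'
    exact ⟨r, hr, m, (hasValue_relName_iff hA _ _ _).2
      fun s hs => ⟨s, le_rfl, hA _ _ _ _ hm hs⟩⟩
  · intro n m m' q' _ hq'
    obtain ⟨r, hr, hAr⟩ := (hasValue_relName_iff hA _ _ _).1 hq'.1 q' le_rfl
    obtain ⟨s, hs, hAs⟩ := (hasValue_relName_iff hA _ _ _).1 hq'.2 r hr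
    obtain rfl := huniq _ _ _ _ (hA _ _ _ _ hAr hs) hAs
    exact (eq_checkPSet_iff _ _ _).2 (PSet.Equiv.refl _)
  · intro y q' _
    obtain ⟨r, hr, N, hN⟩ := hdiff y q'
    refine ⟨r, hr, Finset.range N, fun n s hs hval => ?_⟩
    obtain ⟨t, ht, hAt⟩ := (hasValue_relName_iff hA _ _ _).1 hval s le_rfl
    exact hN n (by simpa using n.2) t (ht.trans hs) hAt

end Names

/-! ### Hechler forcing -/

theorem HechlerForcing.not_noEventuallyDifferentReals :
    ¬ NoEventuallyDifferentReals.{u, 0} HechlerForcing := by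
  have : Nonempty HechlerForcing := ⟨⟨0, fun _ => 0⟩⟩
  refine DaggerForcing.not_noEventuallyDifferentReals (fun n m p => n < p.len ∧ p.fn n = m)
    ?_ ?_ ?_ ?_
  · rintro n m p q ⟨hn, rfl⟩ hq
    exact ⟨hn.trans_le hq.1, hq.2.1 n hn⟩
  · rintro n m m' p ⟨-, rfl⟩ ⟨-, rfl⟩
    rfl
  · intro n p
    exact ⟨⟨max p.len (n + 1), p.fn⟩, ⟨le_max_left _ _, fun _ _ => rfl, fun _ => le_rfl⟩, _,
      lt_max_of_lt_right n.lt_succ_self, rfl⟩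
  · intro y p
    refine ⟨⟨p.len, fun k => if k < p.len then p.fn k else max (p.fn k) (y k + 1)⟩,
      ⟨le_rfl, fun k hk => if_pos hk, fun k => ?_⟩, p.len, ?_⟩
    · dsimp only
      split_ifs
      · exact le_rfl
      · exact le_max_left _ _
    · rintro n hn r hr ⟨-, hrn⟩
      have := hr.2.2 n
      rw [hrn] at this
      simp only [if_neg hn.not_gt] at this
      omega

/-! ### Laver forcing -/

/-- Above the stem there are arbitrarily long nodes, each of which can serve as the stem of a
smaller Laver tree. -/
theorem IsLaverTree.exists_extension {T : Set (List ℕ)} (hT : IsLaverTree T) (n : ℕ) :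
    ∃ t ∈ T, n ≤ t.length ∧ (∀ u ∈ T, t <+: u → {k : ℕ | u ++ [k] ∈ T}.Infinite) := by
  obtain ⟨-, s, hs, -, hsucc⟩ := hT
  induction n with
  | zero => exact ⟨s, hs, Nat.zero_le _, hsucc⟩
  | succ n ih =>
    obtain ⟨t, ht, hn, h⟩ := ih
    obtain ⟨k, hk⟩ := (h t ht List.prefix_rfl).nonempty
    exact ⟨t ++ [k], hk, by simpa using hn,
      fun u hu htu => h u hu ((List.prefix_append _ _).trans htu)⟩

/-- The restriction of a Laver tree to the nodes comparable with a node `t` above the stem. -/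
theorem IsLaverTree.restrict {T : Set (List ℕ)} (hT : IsLaverTree T) {t : List ℕ} (ht : t ∈ T)
    (hsucc : ∀ u ∈ T, t <+: u → {k : ℕ | u ++ [k] ∈ T}.Infinite) :
    IsLaverTree {u | u ∈ T ∧ (u <+: t ∨ t <+: u)} := by
  refine ⟨?_, t, ⟨ht, Or.inl List.prefix_rfl⟩, fun u hu => hu.2, fun u hu htu => ?_⟩
  · rintro u ⟨hu, hut⟩ w hw
    refine ⟨hT.1 u hu w hw, ?_⟩
    rcases hut with hut | hut
    · exact Or.inl (hw.trans hut)
    · exact List.prefix_or_prefix_of_prefix hw hut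
  · refine (hsucc u hu.1 htu).mono fun k hk => ⟨hk, Or.inr (htu.trans (List.prefix_append _ _))⟩

/-- Removing from a Laver tree with stem `s` the nodes that agree with `y` somewhere beyond `s`
leaves a Laver tree with stem `s`: each node loses at most one immediate successor. -/
theorem IsLaverTree.avoid {T : Set (List ℕ)} (hT : IsLaverTree T) (y : ℕ → ℕ) :
    ∃ N, IsLaverTree {t | t ∈ T ∧ ∀ n, N ≤ n → t[n]? ≠ some (y n)} := by
  obtain ⟨hcl, s, hs, hcomp, hsucc⟩ := hT
  refine ⟨s.length, ?_, s, ⟨hs, ?_⟩, fun t ht => hcomp t ht.1, ?_⟩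
  · rintro t ⟨ht, hty⟩ w hw
    refine ⟨hcl t ht w hw, fun n hn h => hty n hn ?_⟩
    obtain ⟨v, rfl⟩ := hw
    rw [List.getElem?_append_left (List.getElem?_eq_some_iff.1 h).1, h]
  · intro n hn
    simp [List.getElem?_eq_none hn]
  · rintro t ⟨ht, hty⟩ hst
    refine ((hsucc t ht hst).sdiff (Set.finite_singleton (y t.length))).mono ?_
    rintro k ⟨hk, hky⟩
    refine ⟨hk, fun n hn h => ?_⟩
    rw [List.getElem?_append] at h
    split_ifs at h with hlt
    · exact hty n hn h
    · have hlt' := (List.getElem?_eq_some_iff.1 h).1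
      have : n = t.length := by simp at hlt'; omega
      subst this
      simp at h
      exact hky h

theorem LaverForcing.not_noEventuallyDifferentReals :
    ¬ NoEventuallyDifferentReals.{u, 0} LaverForcing := by
  have : Nonempty LaverForcing :=
    ⟨⟨Set.univ, by simp, [], trivial, by simp, by simpa using Set.infinite_univ⟩⟩
  refine DaggerForcing.not_noEventuallyDifferentReals
    (fun n m T => ∀ t ∈ T.1, n < t.length → t[n]? = some m) ?_ ?_ ?_ ?_
  · intro n m T T' h hT t ht
    exact h t (hT ht)
  · intro n m m' T h h'
    obtain ⟨t, ht, hn, -⟩ := T.2.exists_extension (n + 1)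
    exact Option.some_injective _ ((h t ht hn).symm.trans (h' t ht hn))
  · intro n T
    obtain ⟨t, ht, hn, hsucc⟩ := T.2.exists_extension (n + 1)
    refine ⟨⟨_, T.2.restrict ht hsucc⟩, fun u hu => hu.1, t[n], ?_⟩
    rintro u ⟨-, ⟨w, hw⟩ | ⟨w, rfl⟩⟩ hu
    · subst hw
      simp [List.getElem_append_left hu]
    · rw [List.getElem?_append_left hn, List.getElem?_eq_getElem hn]
  · intro y T
    obtain ⟨N, hN⟩ := T.2.avoid y
    refine ⟨⟨_, hN⟩, fun u hu => hu.1, N, fun n hn r hr h => ?_⟩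
    obtain ⟨t, ht, hnt, -⟩ := r.2.exists_extension (n + 1)
    exact (hr ht).2 n hn (h t ht hnt)

/-! ### Random forcing -/

open MeasureTheory

/-- The set of `x` with `⌊2ⁿ x⌋ = m`. The eventually different real added by a random real `x` is
`n ↦ ⌊2ⁿ x⌋`; the measures of the cells at level `n` are at most `2⁻ⁿ`, hence summable. -/
def dyadicCell (n m : ℕ) : Set ℝ := {x | ⌊2 ^ n * x⌋₊ = m}

theorem measurableSet_dyadicCell (n m : ℕ) : MeasurableSet (dyadicCell n m) :=
  (Nat.measurable_floor.comp (measurable_const_mul _)) (measurableSet_singleton m)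

theorem volume_dyadicCell_inter_le (n m : ℕ) :
    volume (dyadicCell n m ∩ Set.Icc 0 1) ≤ (2 : ENNReal)⁻¹ ^ n := by
  have hpos : (0 : ℝ) < 2 ^ n := by positivity
  have hsub : dyadicCell n m ∩ Set.Icc 0 1 ⊆ Set.Icc (m / 2 ^ n : ℝ) ((m + 1) / 2 ^ n) := by
    rintro x ⟨hx, hx0, -⟩
    rw [dyadicCell, Set.mem_ofPred_eq, Nat.floor_eq_iff (by positivity)] at hx
    exact ⟨(div_le_iff₀' hpos).2 hx.1, (le_div_iff₀' hpos).2 hx.2.le⟩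
  refine (measure_mono hsub).trans ?_
  rw [Real.volume_Icc, ← sub_div, add_sub_cancel_left, one_div,
    ENNReal.ofReal_inv_of_pos hpos, ENNReal.ofReal_pow (by norm_num), ENNReal.ofReal_ofNat,
    ENNReal.inv_pow]

/-- By the Borel–Cantelli lemma almost no `x` satisfies `⌊2ⁿ x⌋ = y n` infinitely often, so
a positive set has a positive subset on which agreement stops at a fixed level. -/
theorem exists_pos_diff_dyadicCell {B : Set ℝ} (hB : B ⊆ Set.Icc 0 1) (hpos : volume B ≠ 0)
    (y : ℕ → ℕ) : ∃ N, volume (B \ ⋃ n ≥ N, dyadicCell n (y n)) ≠ 0 := by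
  by_contra! h
  have hsum : ∑' n, volume (dyadicCell n (y n) ∩ Set.Icc 0 1) ≠ ⊤ := by
    refine ne_top_of_le_ne_top ?_ (ENNReal.tsum_le_tsum fun n => volume_dyadicCell_inter_le n (y n))
    rw [ENNReal.tsum_geometric]
    simp
  have hlim := measure_setOfPred_frequently_eq_zero
    (p := fun n x => x ∈ dyadicCell n (y n) ∩ Set.Icc (0 : ℝ) 1) hsum
  refine hpos (measure_mono_null ?_ (measure_union_null hlim (measure_iUnion_null h)))
  intro x hx
  by_cases hf : ∃ᶠ n in Filter.atTop, x ∈ dyadicCell n (y n) ∩ Set.Icc (0 : ℝ) 1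
  · exact Or.inl hf
  · rw [Filter.not_frequently, Filter.eventually_atTop] at hf
    obtain ⟨N, hN⟩ := hf
    refine Or.inr (Set.mem_iUnion.2 ⟨N, hx, ?_⟩)
    simp only [Set.mem_iUnion, not_exists]
    exact fun n hn hxn => hN n hn ⟨hxn, hB hx⟩

theorem exists_pos_inter_dyadicCell {B : Set ℝ} (hpos : volume B ≠ 0) (n : ℕ) :
    ∃ m, volume (B ∩ dyadicCell n m) ≠ 0 := by
  by_contra! h
  refine hpos (measure_mono_null ?_ (measure_iUnion_null h))
  exact fun x hx => Set.mem_iUnion.2 ⟨⌊2 ^ n * x⌋₊, hx, rfl⟩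

theorem RandomForcing.not_noEventuallyDifferentReals :
    ¬ NoEventuallyDifferentReals.{u, 0} RandomForcing := by
  have : Nonempty RandomForcing :=
    ⟨toAntisymmetrization _ ⟨Set.Icc 0 1, subset_rfl, measurableSet_Icc, by simp⟩⟩
  let R : RandomForcing → PositiveBorel := ofAntisymmetrization (· ≤ ·)
  have hR {a b : RandomForcing} : a ≤ b ↔ volume ((R a).1 \ (R b).1) = 0 :=
    ofAntisymmetrization_le_ofAntisymmetrization_iff.symm
  have hlow (p : RandomForcing) (B : Set ℝ) (hB : B ⊆ (R p).1) (hm : MeasurableSet B)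
      (hpos : volume B ≠ 0) : ∃ q ≤ p, volume ((R q).1 \ B) = 0 := by
    let b : PositiveBorel := ⟨B, hB.trans (R p).2.1, hm, hpos⟩
    have hb : R (toAntisymmetrization _ b) ≤ b :=
      toAntisymmetrization_le_toAntisymmetrization_iff.1
        (toAntisymmetrization_ofAntisymmetrization _ _).le
    exact ⟨toAntisymmetrization _ b,
      hR.2 (measure_mono_null (Set.sdiff_subset_sdiff_right hB) hb), hb⟩
  refine DaggerForcing.not_noEventuallyDifferentReals
    (fun n m p => volume ((R p).1 \ dyadicCell n m) = 0) ?_ ?_ ?_ ?_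
  · intro n m p q h hq
    refine measure_mono_null ?_ (measure_union_null (hR.1 hq) h)
    intro x hx
    by_cases hxp : x ∈ (R p).1
    · exact Or.inr ⟨hxp, hx.2⟩
    · exact Or.inl ⟨hx.1, hxp⟩
  · intro n m m' p h h'
    by_contra hne
    refine (R p).2.2.2 (measure_mono_null ?_ (measure_union_null h h'))
    intro x hx
    by_cases hxm : x ∈ dyadicCell n m
    · exact Or.inr ⟨hx, fun hxm' => hne (hxm.symm.trans hxm')⟩
    · exact Or.inl ⟨hx, hxm⟩
  · intro n p
    obtain ⟨m, hm⟩ := exists_pos_inter_dyadicCell (R p).2.2.2 n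
    obtain ⟨q, hq, hqm⟩ := hlow p _ Set.inter_subset_left
      ((R p).2.2.1.inter (measurableSet_dyadicCell n m)) hm
    exact ⟨q, hq, m, measure_mono_null (Set.sdiff_subset_sdiff_right Set.inter_subset_right) hqm⟩
  · intro y p
    obtain ⟨N, hN⟩ := exists_pos_diff_dyadicCell (R p).2.1 (R p).2.2.2 y
    obtain ⟨q, hq, hqN⟩ := hlow p _ Set.sdiff_subset ((R p).2.2.1.diff
      (.iUnion fun n => .iUnion fun _ => measurableSet_dyadicCell n (y n))) hN
    refine ⟨q, hq, N, fun n hn r hr h => (R r).2.2.2 (measure_mono_null ?_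
      (measure_union_null (measure_union_null (hR.1 hr) hqN) h))⟩
    intro x hx
    by_cases hxn : x ∈ dyadicCell n (y n)
    · refine Or.inl ?_
      by_cases hxq : x ∈ (R q).1
      · refine Or.inr ⟨hxq, fun hx' => hx'.2 ?_⟩
        exact Set.mem_iUnion₂.2 ⟨n, hn, hxn⟩
      · exact Or.inl ⟨hx, hxq⟩
    · exact Or.inr ⟨hx, hxn⟩

end DaggerForcing

theorem proposition6p1 :
    (∀ {P : Type v} [Preorder P] [Small.{u} P] (e : P ↪ ZFSet.{u}),
      DaggerForcing.Dagger e → DaggerForcing.NoEventuallyDifferentReals.{u, v} P) ∧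
    (∀ e : DaggerForcing.RandomForcing ↪ ZFSet.{u}, ¬ DaggerForcing.Dagger e) ∧
    (∀ e : DaggerForcing.HechlerForcing ↪ ZFSet.{u}, ¬ DaggerForcing.Dagger e) ∧
    (∀ e : DaggerForcing.LaverForcing ↪ ZFSet.{u}, ¬ DaggerForcing.Dagger e) :=
  ⟨fun _ he => he.noEventuallyDifferentReals,
    fun _ he => DaggerForcing.RandomForcing.not_noEventuallyDifferentReals
      he.noEventuallyDifferentReals,
    fun _ he => DaggerForcing.HechlerForcing.not_noEventuallyDifferentReals
      he.noEventuallyDifferentReals,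
    fun _ he => DaggerForcing.LaverForcing.not_noEventuallyDifferentReals
      he.noEventuallyDifferentReals⟩
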